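/- Definitions. For a sequence $(u_j)_{j\in\mathbb N}$ in an additively written commutative group $A$, the IP-set generated by $(u_j)$ is $\{\sum_{j\in\gamma}u_j:\ \gamma\subset\mathbb N,\ 0<|\gamma|<\infty\}$. A subset of $A$ is an IP*-set if it has non-empty intersection with every IP-set in $A$. Let $G$ be a ring (not necessarily commutative, not necessarily with $1$). A mapping $P=(p_1,\dots,p_t):G^n\to G^t$ is polynomial if each $p_i:G^n\to G$ is a polynomial over $G$, i.e. is obtained from constants and the coordinate functions $x_1,\dots,x_n$ by finitely many additions, subtractions and multiplications. A mapping $\mathbb Z^t\to\mathbb Z^m$ (in (b) and (c)) is polynomial if each of its components is given by a polynomial with rational coefficients. A mapping $P:W\to V$ of vector spaces over a field $\mathbf K$ is polynomial if $P(w)=\sum_{k=0}^{d}M_k(w,\dots,w)$ for some $d$ and some $k$-linear mappings $M_k:W^k\to V$ over $\mathbf K$. (a) Let $G$ be a ring and let $P:G^n\to G^t$ be a polynomial mapping with $P(0)=0$. Given a finite set $F\subset G^n$ and a finite coloring $\chi:G^t\to\{1,\dots,r\}$, there is a color $l$, $1\le l\le r$, such that $$\{(x_1,\dots,x_n)\in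 G^n:\ \exists h\in G^t\ \ \forall (v_1,\dots,v_n)\in F\quad \chi\big(h+P(x_1v_1,\dots,x_nv_n)\big)=l\}$$ is an IP*-set in $G^n$. It covers the following results. (b) Let $P:\mathbb Z^t\to\mathbb Z^m$ be a polynomial mapping with $P(0)=0$, $F\subset\mathbb Z^t$ a finite set, $(u_j)_{j\in\mathbb N}$ a sequence in $\mathbb Z^t$, and $n_\gamma=(n_{1,\gamma},\dots,n_{t,\gamma})=\sum_{j\in\gamma}u_j$. For any finite coloring of $\mathbb Z^m$ there exist $a\in\mathbb Z^m$ and a finite non-empty $\gamma\subset\mathbb N$ such that $\{a+P(n_{1,\gamma}v_1,\dots,n_{t,\gamma}v_t):(v_1,\dots,v_t)\in F\}$ is monochromatic. (c) For $P$ and $F$ as in (b) and any finite coloring $\chi:\mathbb Z^m\to\{1,\dots,r\}$ there is $l$, $1\le l\le r$, such that $$\{(n_1,\dots,n_t)\in\mathbb Z^t:\ \exists a\in\mathbb Z^m\ \ \forall (v_1,\dots,v_t)\in F\quad \chi\big(a+P(n_1v_1,\dots,n_tv_t)\big)=l\}$$ is an IP*-set in $\mathbb Z^t$. (d) Let $W,V$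 be vector spaces over an infinite field $\mathbf K$, $P:W\to V$ a polynomial mapping with $P(0)=0$, and $F\subset W$ a finite set. For any finite coloring $\chi:V\to\{1,\dots,r\}$ there are $a\in V$ and a nonzero $n\in\mathbf K$ such that $a+P(nF)$ is monochromatic. Moreover, there is $l$, $1\le l\le r$, such that $$\{n\in\mathbf K:\ \exists a\in V\ \ \forall v\in F\quad \chi(a+P(nv))=l\}$$ is an IP*-set in $(\mathbf K,+)$. -/

import Mathlib

/-- The IP-set generated by a sequence `u`: all sums of finitely many (at least one) terms of `u`
with distinct indices. -/
def ipSet {A : Type*} [AddCommMonoid A] (u : ℕ → A) : Set A :=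
  {x | ∃ γ : Finset ℕ, γ.Nonempty ∧ x = ∑ j ∈ γ, u j}

/-- An IP*-set: a set that meets every IP-set. -/
def IsIPStar {A : Type*} [AddCommMonoid A] (E : Set A) : Prop :=
  ∀ u : ℕ → A, (E ∩ ipSet u).Nonempty

/-- A map `G ^ n → G` is a polynomial over the (not necessarily commutative, not necessarily unital)
ring `G` if it is obtained from the constants and the coordinate functions by finitely many
additions, subtractions and multiplications. So it is a sum of monomials in the noncommuting
variables `x_1, …, x_n`, where coefficients may stand at any place in a monomial; over a
commutative unital ring these are the functions defined by the elements of `G[x_1, …, x_n]`. -/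
def IsRingPolynomial {G : Type*} [NonUnitalRing G] {n : ℕ} (p : (Fin n → G) → G) : Prop :=
  p ∈ NonUnitalSubring.closure
    ({f : (Fin n → G) → G | ∃ c : G, f = fun _ => c} ∪
      {f : (Fin n → G) → G | ∃ i : Fin n, f = fun x => x i})

/-- A polynomial mapping `G ^ n → G ^ t` over a ring `G`: every component is a polynomial. -/
def IsRingPolynomialMap {G : Type*} [NonUnitalRing G] {n t : ℕ}
    (P : (Fin n → G) → (Fin t → G)) : Prop :=
  ∀ i : Fin t, IsRingPolynomial fun x => P x i

/-- A polynomial mapping `ℤ ^ t → ℤ ^ m`: every component is given by a polynomial with rational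
coefficients (which takes integer values at the integer points). -/
def IsIntPolynomialMap {t m : ℕ} (P : (Fin t → ℤ) → (Fin m → ℤ)) : Prop :=
  ∀ i : Fin m, ∃ p : MvPolynomial (Fin t) ℚ, ∀ x : Fin t → ℤ,
    (P x i : ℚ) = MvPolynomial.eval (fun j => (x j : ℚ)) p

/-- A polynomial mapping between vector spaces of arbitrary dimension: a finite sum of homogeneous
mappings `w ↦ M (w, …, w)` with `M` a `k`-linear mapping. -/
def IsVectorPolynomialMap (K : Type*) {W V : Type*} [Field K] [AddCommGroup W] [Module K W]
    [AddCommGroup V] [Module K V] (P : W → V) : Prop :=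
  ∃ (d : ℕ) (M : (k : ℕ) → MultilinearMap K (fun _ : Fin k => W) V),
    ∀ w : W, P w = ∑ k ∈ Finset.range (d + 1), M k (fun _ => w)

/-!
A map is treated as polynomial when all its iterated differences of some order vanish; this covers
the polynomial maps of rings, of `ℤ ^ t` and of vector spaces at once. A minimal subsystem of the
orbit closure of the colouring turns the statement into topological recurrence: if `ξ` lies in the
minimal system, then a return of the open set `{η | η 0 = ξ 0}` gives a translate of the
set of all `f x`, `f ∈ F`, that has the single colour `ξ 0`, whatever the IP-set is.

Recurrence is proved by colour focusing, with finitely many translates of the open set, which cover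
the system by minimality, as the colours. Each focusing step for `F` uses the recurrence of the maps
`x ↦ f (x + y) - f y - h x` with `f ∈ F` and finitely many `y`. When `h` has the least degree among
the leading terms of `F`, this family has a smaller multiset of degrees of leading terms, so that
Bergelson's PET (polynomial exhaustion technique) induction terminates.
-/

open scoped fwdDiff

section PolynomialMaps

variable {B A C : Type*} [AddCommMonoid B] [AddCommGroup A]

variable (B A) in
/-- The maps `B → A` that are polynomial of degree less than `d`, in the sense that all their
`d`-fold forward differences vanish. -/
def polyDegLT : ℕ → AddSubgroup (B → A)
  | 0 => ⊥
  | d + 1 => ⨅ y : B, (polyDegLT d).comap (fwdDiff_aux.fwdDiffₗ B A y).toAddMonoidHom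

theorem mem_polyDegLT_succ {d : ℕ} {f : B → A} :
    f ∈ polyDegLT B A (d + 1) ↔ ∀ y, Δ_[y] f ∈ polyDegLT B A d := by
  simp only [polyDegLT, AddSubgroup.mem_iInf, AddSubgroup.mem_comap, LinearMap.toAddMonoidHom_coe]
  rfl

theorem polyDegLT_mono : Monotone (polyDegLT B A) := by
  refine monotone_nat_of_le_succ fun d => ?_
  induction d with
  | zero => exact bot_le
  | succ d ih => exact fun f hf =>
      mem_polyDegLT_succ.2 fun y => ih (mem_polyDegLT_succ.1 hf y)

theorem const_mem_polyDegLT_one (a : A) : (fun _ => a) ∈ polyDegLT B A 1 :=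
  mem_polyDegLT_succ.2 fun y => fwdDiff_const y a

theorem addMonoidHom_mem_polyDegLT_two (φ : B →+ A) : ⇑φ ∈ polyDegLT B A 2 := by
  refine mem_polyDegLT_succ.2 fun y => ?_
  have : Δ_[y] φ = fun _ => φ y := by ext x; simp [fwdDiff]
  exact this ▸ const_mem_polyDegLT_one _

theorem comp_mem_polyDegLT [AddCommMonoid C] {d : ℕ} {f : B → A} (hf : f ∈ polyDegLT B A d)
    (φ : C →+ B) : f ∘ φ ∈ polyDegLT C A d := by
  induction d generalizing f with
  | zero => exact congrArg (· ∘ φ) (hf : f = 0)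
  | succ d ih =>
    refine mem_polyDegLT_succ.2 fun y => ?_
    have : Δ_[y] (f ∘ φ) = (Δ_[φ y] f) ∘ φ := by ext x; simp [fwdDiff]
    exact this ▸ ih (mem_polyDegLT_succ.1 hf (φ y))

theorem mem_polyDegLT_of_forall_comp {ι : Type*} {C : ι → Type*} [∀ i, AddCommGroup (C i)]
    (φ : ∀ i, A →+ C i) (hφ : ∀ a, (∀ i, φ i a = 0) → a = 0) {d : ℕ} {f : B → A}
    (hf : ∀ i, φ i ∘ f ∈ polyDegLT B (C i) d) : f ∈ polyDegLT B A d := by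
  induction d generalizing f with
  | zero => exact funext fun x => hφ _ fun i => congrFun (hf i : φ i ∘ f = 0) x
  | succ d ih =>
    refine mem_polyDegLT_succ.2 fun y => ih fun i => ?_
    have : φ i ∘ (Δ_[y] f) = Δ_[y] (φ i ∘ f) := by ext x; simp [fwdDiff]
    exact this ▸ mem_polyDegLT_succ.1 (hf i) y

theorem fwdDiff_biadditive {A' : Type*} [AddCommGroup A'] [AddCommGroup C] (m : A →+ A' →+ C)
    (y : B) (f : B → A) (g : B → A') :
    Δ_[y] (fun x => m (f x) (g x)) = (fun x => m (Δ_[y] f x) (g x)) +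
      (fun x => m (f x) (Δ_[y] g x)) + fun x => m (Δ_[y] f x) (Δ_[y] g x) := by
  ext x
  simp only [fwdDiff, Pi.add_apply, map_sub, AddMonoidHom.sub_apply]
  abel

theorem biadditive_mem_polyDegLT {A' : Type*} [AddCommGroup A'] [AddCommGroup C]
    (m : A →+ A' →+ C) {d e : ℕ} {f : B → A} {g : B → A'} (hf : f ∈ polyDegLT B A d)
    (hg : g ∈ polyDegLT B A' e) : (fun x => m (f x) (g x)) ∈ polyDegLT B C (d + e) := by
  induction d generalizing e f g with
  | zero =>
    obtain rfl : f = 0 := hf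
    simp only [Pi.zero_apply, map_zero, AddMonoidHom.zero_apply]
    exact zero_mem _
  | succ d ihd =>
    induction e generalizing g with
    | zero =>
      obtain rfl : g = 0 := hg
      simp only [Pi.zero_apply, map_zero]
      exact zero_mem _
    | succ e ihe =>
      refine mem_polyDegLT_succ.2 fun y => ?_
      have hΔf := mem_polyDegLT_succ.1 hf y
      have hΔg := mem_polyDegLT_succ.1 hg y
      rw [fwdDiff_biadditive]
      refine add_mem (add_mem ?_ (ihe hΔg)) (polyDegLT_mono (by lia) (ihd hΔf hΔg))
      exact polyDegLT_mono (by lia) (ihd hΔf hg)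

variable (B A) in
/-- The polynomial maps `B → A`, of any degree. -/
def polyMaps : AddSubgroup (B → A) := ⨆ d, polyDegLT B A d

theorem mem_polyMaps {f : B → A} : f ∈ polyMaps B A ↔ ∃ d, f ∈ polyDegLT B A d :=
  AddSubgroup.mem_iSup_of_directed polyDegLT_mono.directed_le

theorem const_mem_polyMaps (a : A) : (fun _ => a) ∈ polyMaps B A :=
  mem_polyMaps.2 ⟨1, const_mem_polyDegLT_one a⟩

theorem addMonoidHom_mem_polyMaps (φ : B →+ A) : ⇑φ ∈ polyMaps B A :=
  mem_polyMaps.2 ⟨2, addMonoidHom_mem_polyDegLT_two φ⟩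

theorem comp_mem_polyMaps [AddCommMonoid C] {f : B → A} (hf : f ∈ polyMaps B A) (φ : C →+ B) :
    f ∘ φ ∈ polyMaps C A := by
  obtain ⟨d, hd⟩ := mem_polyMaps.1 hf
  exact mem_polyMaps.2 ⟨d, comp_mem_polyDegLT hd φ⟩

theorem exists_forall_mem_polyDegLT {F : Set (B → A)} (hF : F.Finite)
    (hpoly : F ⊆ polyMaps B A) : ∃ d, F ⊆ polyDegLT B A d := by
  choose! d hd using fun f (hf : f ∈ F) => mem_polyMaps.1 (hpoly hf)
  obtain ⟨N, hN⟩ := (hF.image d).bddAbove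
  exact ⟨N, fun f hf => polyDegLT_mono (hN (Set.mem_image_of_mem d hf)) (hd f hf)⟩

theorem mem_polyMaps_of_forall_comp {ι : Type*} [Finite ι] {C : ι → Type*}
    [∀ i, AddCommGroup (C i)] (φ : ∀ i, A →+ C i) (hφ : ∀ a, (∀ i, φ i a = 0) → a = 0)
    {f : B → A} (hf : ∀ i, φ i ∘ f ∈ polyMaps B (C i)) : f ∈ polyMaps B A := by
  choose d hd using fun i => mem_polyMaps.1 (hf i)
  obtain ⟨N, hN⟩ := (Set.finite_range d).bddAbove
  exact mem_polyMaps.2 ⟨N, mem_polyDegLT_of_forall_comp φ hφ fun i =>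
    polyDegLT_mono (hN ⟨i, rfl⟩) (hd i)⟩

theorem biadditive_mem_polyMaps {A' : Type*} [AddCommGroup A'] [AddCommGroup C]
    (m : A →+ A' →+ C) {f : B → A} {g : B → A'} (hf : f ∈ polyMaps B A)
    (hg : g ∈ polyMaps B A') : (fun x => m (f x) (g x)) ∈ polyMaps B C := by
  obtain ⟨d, hd⟩ := mem_polyMaps.1 hf
  obtain ⟨e, he⟩ := mem_polyMaps.1 hg
  exact mem_polyMaps.2 ⟨d + e, biadditive_mem_polyDegLT m hd he⟩

theorem mul_mem_polyMaps {R : Type*} [NonUnitalRing R] {f g : B → R} (hf : f ∈ polyMaps B R)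
    (hg : g ∈ polyMaps B R) : f * g ∈ polyMaps B R :=
  biadditive_mem_polyMaps AddMonoidHom.mul hf hg

theorem pow_mem_polyMaps {R : Type*} [Ring R] {f : B → R} (hf : f ∈ polyMaps B R) (k : ℕ) :
    f ^ k ∈ polyMaps B R := by
  induction k with
  | zero => exact pow_zero f ▸ const_mem_polyMaps 1
  | succ k ih => exact pow_succ f k ▸ mul_mem_polyMaps ih hf

end PolynomialMaps

section PET

variable {B A : Type*} [AddCommMonoid B] [AddCommGroup A]

variable (B A) in
/-- The polynomial maps of degree less than `d` that send `0` to `0`. -/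
def basedPolyDegLT (d : ℕ) : AddSubgroup (B → A) :=
  polyDegLT B A d ⊓ (Pi.evalAddMonoidHom (fun _ => A) 0).ker

theorem mem_basedPolyDegLT {d : ℕ} {f : B → A} :
    f ∈ basedPolyDegLT B A d ↔ f ∈ polyDegLT B A d ∧ f 0 = 0 :=
  Iff.rfl

theorem basedPolyDegLT_mono : Monotone (basedPolyDegLT B A) :=
  fun _ _ h => inf_le_inf_right _ (polyDegLT_mono h)

theorem sub_apply_zero_mem_basedPolyDegLT {d : ℕ} {f : B → A} (hf : f ∈ polyDegLT B A d) :
    (fun x => f x - f 0) ∈ basedPolyDegLT B A d := by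
  refine mem_basedPolyDegLT.2 ⟨?_, sub_self _⟩
  cases d with
  | zero =>
    obtain rfl : f = 0 := hf
    exact funext fun _ => sub_self 0
  | succ d => exact sub_mem hf (polyDegLT_mono (by lia) (const_mem_polyDegLT_one (f 0)))

theorem apply_add_sub_apply_sub_mem_basedPolyDegLT {d : ℕ} {f g : B → A}
    (hg : g ∈ basedPolyDegLT B A (d + 1)) (hfg : f - g ∈ basedPolyDegLT B A d) (y : B) :
    (fun x => f (x + y) - f y - g x) ∈ basedPolyDegLT B A d := by
  have hf : f ∈ basedPolyDegLT B A (d + 1) := by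
    simpa using add_mem (basedPolyDegLT_mono d.le_succ hfg) hg
  have hf0 : f 0 = 0 := (mem_basedPolyDegLT.1 hf).2
  have hΔ := sub_apply_zero_mem_basedPolyDegLT (mem_polyDegLT_succ.1 hf.1 y)
  convert add_mem hΔ hfg using 1
  ext x
  simp only [fwdDiff, Pi.add_apply, Pi.sub_apply, zero_add, hf0]
  abel

/-- The maps whose recurrence is needed to focus one more colour: after moving the focus by `-h x`,
the parameters `x + y` with `y ∈ Y` still produce the colours that the parameters `y` produced, and
the parameter `x` itself produces a new one. -/
def shiftFamily (F : Set (B → A)) (h : B → A) (Y : Set B) : Set (B → A) :=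
  Set.image2 (fun f y x => f (x + y) - f y - h x) F (insert 0 Y)

theorem finite_shiftFamily {F : Set (B → A)} (hF : F.Finite) (h : B → A) {Y : Set B}
    (hY : Y.Finite) : (shiftFamily F h Y).Finite :=
  hF.image2 _ (hY.insert 0)

/-- The multiset `L` of pairs (degree, leading term) dominates the family `F`: each nonzero member
of `F` agrees with one of the leading terms up to lower degree. -/
structure IsDominated (F : Set (B → A)) (L : Multiset (ℕ × (B → A))) : Prop where
  leading_mem : ∀ c ∈ L, c.2 ∈ basedPolyDegLT B A (c.1 + 1)
  exists_leading : ∀ f ∈ F, f ≠ 0 → ∃ c ∈ L, f - c.2 ∈ basedPolyDegLT B A c.1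

theorem exists_isDominated {F : Set (B → A)} (hF : F.Finite) {d : ℕ}
    (hd : F ⊆ basedPolyDegLT B A d) : ∃ L, (∀ c ∈ L, c.1 < d) ∧ IsDominated F L := by
  cases d with
  | zero =>
    exact ⟨0, by simp, by simp, fun f hf hf0 => (hf0 (mem_basedPolyDegLT.1 (hd hf)).1).elim⟩
  | succ d =>
    refine ⟨hF.toFinset.val.map (d, ·), ?_, ?_, fun f hf _ => ⟨(d, f), by simpa, by simp⟩⟩
    · simp
    · simpa using fun f hf => hd hf

theorem IsDominated.apply_zero {F : Set (B → A)} {L : Multiset (ℕ × (B → A))}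
    (hFL : IsDominated F L) {f : B → A} (hf : f ∈ F) : f 0 = 0 := by
  rcases eq_or_ne f 0 with rfl | hf0
  · rfl
  obtain ⟨c, hc, hfc⟩ := hFL.exists_leading f hf hf0
  have hc0 := (mem_basedPolyDegLT.1 (hFL.leading_mem c hc)).2
  simpa only [Pi.sub_apply, hc0, sub_zero] using (mem_basedPolyDegLT.1 hfc).2

theorem IsDominated.exists_shiftFamily {F : Set (B → A)} (hF : F.Finite) (hF0 : 0 ∉ F) {d : ℕ}
    {h : B → A} {L : Multiset (ℕ × (B → A))} (hmin : ∀ c ∈ L, d ≤ c.1)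
    (hFL : IsDominated F ((d, h) ::ₘ L)) {Y : Set B} (hY : Y.Finite) :
    ∃ t : Multiset (ℕ × (B → A)), (∀ c ∈ t, c.1 < d) ∧
      IsDominated (shiftFamily F h Y) (t + L.map fun c => (c.1, c.2 - h)) := by
  obtain ⟨t, htd, ht⟩ := exists_isDominated (d := d)
    (F := {q ∈ shiftFamily F h Y | q ∈ basedPolyDegLT B A d})
    ((finite_shiftFamily hF h hY).subset fun _ hq => hq.1) fun _ hq => hq.2
  have hlead := Multiset.forall_mem_cons.1 hFL.leading_mem
  refine ⟨t, htd, fun c hc => ?_, fun q hq hq0 => ?_⟩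
  · rcases Multiset.mem_add.1 hc with hc | hc
    · exact ht.leading_mem c hc
    · obtain ⟨c, hcL, rfl⟩ := Multiset.mem_map.1 hc
      have hdc : d + 1 ≤ c.1 + 1 := Nat.succ_le_succ (hmin c hcL)
      exact sub_mem (hlead.2 c hcL) (basedPolyDegLT_mono hdc hlead.1)
  · obtain ⟨f, hf, y, -, rfl⟩ := id hq
    obtain ⟨c, hc, hfc⟩ := hFL.exists_leading f hf fun h0 => hF0 (h0 ▸ hf)
    have hshift :=
      apply_add_sub_apply_sub_mem_basedPolyDegLT (hFL.leading_mem c hc) hfc y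
    rcases Multiset.mem_cons.1 hc with rfl | hcL
    · obtain ⟨c, hct, hqc⟩ := ht.exists_leading _ ⟨hq, hshift⟩ hq0
      exact ⟨c, Multiset.mem_add.2 (.inl hct), hqc⟩
    · refine ⟨(c.1, c.2 - h), Multiset.mem_add.2 (.inr (Multiset.mem_map_of_mem _ hcL)), ?_⟩
      convert hshift using 1
      ext x
      exact sub_sub_sub_cancel_right _ _ _

theorem IsDominated.induction {motive : Set (B → A) → Prop} (empty : motive ∅)
    (of_diff_zero : ∀ F, motive (F \ {0}) → motive F)
    (of_shiftFamily : ∀ F h, F.Finite → (∀ f ∈ F, f 0 = 0) →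
      (∀ Y : Set B, Y.Finite → motive (shiftFamily F h Y)) → motive F)
    {F : Set (B → A)} (hF : F.Finite) {L : Multiset (ℕ × (B → A))} (hFL : IsDominated F L) :
    motive F := by
  have wf : WellFounded (Relation.CutExpand (α := ℕ) (· < ·)) := Nat.lt_wfRel.wf.cutExpand
  induction hs : L.map Prod.fst using wf.induction generalizing F L with
  | _ s ih =>
  subst hs
  refine of_diff_zero F ?_
  have hFL' : IsDominated (F \ {0}) L :=
    ⟨hFL.leading_mem, fun f hf => hFL.exists_leading f hf.1⟩
  rcases eq_or_ne L 0 with rfl | hL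
  · have : F \ {0} = ∅ := Set.eq_empty_of_forall_notMem fun f hf => by
      simpa using hFL'.exists_leading f hf hf.2
    exact this ▸ empty
  obtain ⟨⟨d, h⟩, hmem, hmin⟩ := exists_minimalFor_of_wellFoundedLT (· ∈ L) Prod.fst
    (Multiset.exists_mem_of_ne_zero hL)
  obtain ⟨L, rfl⟩ := Multiset.exists_cons_of_mem hmem
  have hmin' : ∀ c ∈ L, d ≤ c.1 := fun c hc =>
    (le_total d c.1).elim id (hmin (Multiset.mem_cons_of_mem hc))
  have h0F : (0 : B → A) ∉ F \ {0} := fun h0 => h0.2 rfl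
  refine of_shiftFamily _ h hF.sdiff (fun f => hFL'.apply_zero) fun Y hY => ?_
  obtain ⟨t, ht, hdom⟩ := hFL'.exists_shiftFamily hF.sdiff h0F hmin' hY
  refine ih _ ⟨t.map Prod.fst, d, by simpa using ht, ?_⟩
    (finite_shiftFamily hF.sdiff h hY) hdom rfl
  simp only [Multiset.map_add, Multiset.map_map, Function.comp_def, Multiset.map_cons]
  rw [← Multiset.singleton_add]
  abel

theorem pet_induction {motive : Set (B → A) → Prop} (empty : motive ∅)
    (of_diff_zero : ∀ F, motive (F \ {0}) → motive F)
    (of_shiftFamily : ∀ F h, F.Finite → (∀ f ∈ F, f 0 = 0) →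
      (∀ Y : Set B, Y.Finite → motive (shiftFamily F h Y)) → motive F)
    {F : Set (B → A)} (hF : F.Finite) (hpoly : F ⊆ polyMaps B A) (hF0 : ∀ f ∈ F, f 0 = 0) :
    motive F := by
  obtain ⟨d, hd⟩ := exists_forall_mem_polyDegLT hF hpoly
  obtain ⟨L, -, hFL⟩ := exists_isDominated hF fun f hf => mem_basedPolyDegLT.2 ⟨hd hf, hF0 f hf⟩
  exact hFL.induction empty of_diff_zero of_shiftFamily hF

end PET

section IPSets

variable {B : Type*} [AddCommMonoid B] {u : ℕ → B}

theorem mem_ipSet_of_tail {M : ℕ} {x : B} (hx : x ∈ ipSet fun j => u (j + M)) : x ∈ ipSet u := by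
  obtain ⟨γ, hγ, rfl⟩ := hx
  exact ⟨γ.map (addRightEmbedding M), hγ.map, by simp⟩

theorem eventually_add_tail_mem_ipSet {y : B} (hy : y ∈ ipSet u) :
    ∀ᶠ M in Filter.atTop, ∀ x ∈ ipSet fun j => u (j + M), x + y ∈ ipSet u := by
  obtain ⟨γ, hγ, rfl⟩ := hy
  filter_upwards [Filter.eventually_gt_atTop (γ.sup id)] with M hM
  rintro _ ⟨δ, -, rfl⟩
  have hdisj : Disjoint (δ.map (addRightEmbedding M)) γ := by
    refine Finset.disjoint_left.2 fun a ha haγ => ?_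
    obtain ⟨b, -, rfl⟩ := Finset.mem_map.1 ha
    exact (Nat.le_add_left M b).not_gt ((Finset.le_sup (f := id) haγ).trans_lt hM)
  exact ⟨(δ.map (addRightEmbedding M)).disjUnion γ hdisj, by simp [hγ],
    by rw [Finset.sum_disjUnion, Finset.sum_map]; rfl⟩

theorem exists_tail_add_mem_ipSet {Y : Set B} (hY : Y.Finite) (hYu : Y ⊆ ipSet u) :
    ∃ M, ∀ x ∈ ipSet fun j => u (j + M), insert x ((x + ·) '' Y) ⊆ ipSet u := by
  obtain ⟨M, hM⟩ := ((Set.Finite.eventually_all hY).2 fun y hy =>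
    eventually_add_tail_mem_ipSet (hYu hy)).exists
  refine ⟨M, fun x hx => Set.insert_subset (mem_ipSet_of_tail hx) ?_⟩
  rintro _ ⟨y, hy, rfl⟩
  exact hM y hy x hx

end IPSets

section Focusing

open scoped Pointwise

variable {B A X : Type*} [AddCommMonoid B] [AddCommGroup A] [TopologicalSpace X] [AddAction A X]

variable (X) in
/-- Recurrence of `F` along IP-sets in the dynamical system `X`: every nonempty open set `U`
contains, for some `x` in any given IP-set, a point that returns to `U` under the translations by
all the `f x`, `f ∈ F`. -/
def IsIPRecurrent (F : Set (B → A)) : Prop :=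
  ∀ U : Set X, IsOpen U → U.Nonempty → IsIPStar {x | ∃ p ∈ U, ∀ f ∈ F, f x +ᵥ p ∈ U}

theorem isIPRecurrent_empty : IsIPRecurrent X (∅ : Set (B → A)) :=
  fun _ _ ⟨p, hp⟩ u => ⟨∑ j ∈ {0}, u j, ⟨p, hp, by simp⟩, {0}, Finset.singleton_nonempty 0, rfl⟩

theorem IsIPRecurrent.of_diff_zero {F : Set (B → A)} (hF : IsIPRecurrent X (F \ {0})) :
    IsIPRecurrent X F := by
  intro U hU hne u
  obtain ⟨x, ⟨p, hpU, hp⟩, hxu⟩ := hF U hU hne u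
  refine ⟨x, ⟨p, hpU, fun f hf => ?_⟩, hxu⟩
  rcases eq_or_ne f 0 with rfl | hf0
  · simpa using hpU
  · exact hp f ⟨hf, hf0⟩

/-- The translates `c +ᵥ U`, `c ∈ J`, are focused on a common open set `V`, with parameters in the
IP-set of `u`: each of them contains, for some parameter `y`, all the translates of `V` by the
`f y`, `f ∈ F`. They play the role of the colours of the spokes in a colour focusing argument. -/
def IsFocused (u : ℕ → B) (F : Set (B → A)) (U : Set X) (J : Finset A) : Prop :=
  ∃ V : Set X, IsOpen V ∧ V.Nonempty ∧ ∃ Y : Set B, Y.Finite ∧ Y ⊆ ipSet u ∧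
    ∀ c ∈ J, ∃ y ∈ Y, ∀ f ∈ F, ∀ p ∈ V, f y +ᵥ p ∈ c +ᵥ U

theorem exists_isOpen_forall_sub_vadd_mem [ContinuousConstVAdd A X] {F : Set (B → A)}
    (hF : F.Finite) {h : B → A} {Y : Set B} (hY : Y.Finite) {V : Set X} (hV : IsOpen V) {x : B}
    {p : X} (hp : ∀ g ∈ shiftFamily F h Y, g x +ᵥ p ∈ V) :
    ∃ V' : Set X, IsOpen V' ∧ V'.Nonempty ∧
      ∀ p' ∈ V', ∀ f ∈ F, ∀ y ∈ insert 0 Y, (f (x + y) - f y) +ᵥ p' ∈ V := by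
  refine ⟨⋂ g ∈ shiftFamily F h Y, ((g x + h x) +ᵥ ·) ⁻¹' V,
    (finite_shiftFamily hF h hY).isOpen_biInter fun g _ => hV.preimage (continuous_const_vadd _),
    ⟨-h x +ᵥ p, Set.mem_iInter₂.2 fun g hg => ?_⟩, fun p' hp' f hf y hy => ?_⟩
  · simpa [vadd_vadd] using hp g hg
  · simpa using Set.mem_iInter₂.1 hp' _ (Set.mem_image2_of_mem hf hy)

theorem IsFocused.exists_insert [DecidableEq A] [ContinuousConstVAdd A X] {u : ℕ → B}
    {F : Set (B → A)} (hF : F.Finite) (hF0 : ∀ f ∈ F, f 0 = 0) {h : B → A}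
    (hrec : ∀ Y : Set B, Y.Finite → IsIPRecurrent X (shiftFamily F h Y)) {U : Set X}
    (hU : IsOpen U) {I : Finset A} (hI : Set.univ ⊆ ⋃ c ∈ I, c +ᵥ U)
    (hu : ∀ x ∈ ipSet u, ∀ p ∈ U, ∃ f ∈ F, f x +ᵥ p ∉ U) {J : Finset A} (hJ : IsFocused u F U J) :
    ∃ c ∈ I, c ∉ J ∧ IsFocused u F U (insert c J) := by
  obtain ⟨V, hV, ⟨q, hq⟩, Y, hY, hYu, hfoc⟩ := hJ
  obtain ⟨c, hcI, hcq⟩ := Set.mem_iUnion₂.1 (hI (Set.mem_univ q))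
  obtain ⟨M, hM⟩ := exists_tail_add_mem_ipSet hY hYu
  have hVc : IsOpen (V ∩ (c +ᵥ U)) := hV.inter (hU.vadd c)
  obtain ⟨x, ⟨p, hp, hpx⟩, hxu⟩ := hrec Y hY _ hVc ⟨q, hq, hcq⟩ fun j => u (j + M)
  obtain ⟨V', hV', hne, hV'_vadd⟩ := exists_isOpen_forall_sub_vadd_mem hF hY hVc hpx
  refine ⟨c, hcI, fun hcJ => ?_, V', hV', hne, _, (hY.image _).insert x, hM x hxu, fun b hb => ?_⟩
  · obtain ⟨y, hy, hyU⟩ := hfoc c hcJ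
    obtain ⟨hpV, p₀, hp₀, rfl⟩ := hp
    obtain ⟨f, hf, hfU⟩ := hu y (hYu hy) p₀ hp₀
    have hfc : f y +ᵥ (c +ᵥ p₀) ∈ c +ᵥ U := hyU f hf _ hpV
    rw [vadd_comm] at hfc
    exact hfU (Set.vadd_mem_vadd_set_iff.1 hfc)
  rcases Finset.mem_insert.1 hb with rfl | hbJ
  · refine ⟨x, Set.mem_insert _ _, fun f hf p' hp' => ?_⟩
    simpa [hF0 f hf] using (hV'_vadd p' hp' f hf 0 (Set.mem_insert _ _)).2
  · obtain ⟨y, hy, hyU⟩ := hfoc b hbJ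
    refine ⟨x + y, Set.mem_insert_of_mem _ ⟨y, hy, rfl⟩, fun f hf p' hp' => ?_⟩
    simpa [vadd_vadd] using hyU f hf _ (hV'_vadd p' hp' f hf y (Set.mem_insert_of_mem _ hy)).1

theorem IsIPRecurrent.of_shiftFamily [ContinuousConstVAdd A X] [CompactSpace X]
    [AddAction.IsMinimal A X] {F : Set (B → A)} (hF : F.Finite) (hF0 : ∀ f ∈ F, f 0 = 0)
    {h : B → A} (hrec : ∀ Y : Set B, Y.Finite → IsIPRecurrent X (shiftFamily F h Y)) :
    IsIPRecurrent X F := by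
  classical
  intro U hU hne u
  by_contra hcon
  have hu : ∀ x ∈ ipSet u, ∀ p ∈ U, ∃ f ∈ F, f x +ᵥ p ∉ U := by
    by_contra! hx
    obtain ⟨x, hxu, p, hp⟩ := hx
    exact hcon ⟨x, ⟨p, hp⟩, hxu⟩
  obtain ⟨I, hI⟩ := isCompact_univ.exists_finite_cover_vadd A hU hne
  have hfocused : ∀ s, ∃ J ⊆ I, J.card = s ∧ IsFocused u F U J := by
    intro s
    induction s with
    | zero =>
      exact ⟨∅, I.empty_subset, rfl, Set.univ, isOpen_univ, hne.mono U.subset_univ, ∅,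
        Set.finite_empty, Set.empty_subset _, by simp⟩
    | succ s ih =>
      obtain ⟨J, hJI, rfl, hJ⟩ := ih
      obtain ⟨c, hcI, hcJ, hc⟩ := hJ.exists_insert hF hF0 hrec hU hI hu
      exact ⟨insert c J, Finset.insert_subset hcI hJI, Finset.card_insert_of_notMem hcJ, hc⟩
  obtain ⟨J, hJI, hcard, -⟩ := hfocused (I.card + 1)
  exact (Finset.card_le_card hJI).not_gt (hcard ▸ I.card.lt_succ_self)

theorem isIPRecurrent_of_subset_polyMaps [ContinuousConstVAdd A X] [CompactSpace X]
    [AddAction.IsMinimal A X] {F : Set (B → A)} (hF : F.Finite) (hpoly : F ⊆ polyMaps B A)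
    (hF0 : ∀ f ∈ F, f 0 = 0) :
    IsIPRecurrent X F :=
  pet_induction isIPRecurrent_empty (fun _ => IsIPRecurrent.of_diff_zero)
    (fun _ _ hF hF0 => IsIPRecurrent.of_shiftFamily hF hF0) hF hpoly hF0

end Focusing

section MinimalSubsystem

open scoped Pointwise

variable {A X : Type*} [AddMonoid A] [TopologicalSpace X] [AddAction A X]

instance [ContinuousConstVAdd A X] (M : SubAddAction A X) : ContinuousConstVAdd A M :=
  ⟨fun c => ((continuous_const_vadd c).comp continuous_subtype_val).subtype_mk _⟩

variable (A X) in
/-- The nonempty closed subsets of `X` that are invariant under the action of `A`. -/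
def subsystems : Set (Set X) :=
  {S | IsClosed S ∧ S.Nonempty ∧ ∀ c : A, c +ᵥ S ⊆ S}

theorem closure_orbit_mem_subsystems [ContinuousConstVAdd A X] (x : X) :
    closure (AddAction.orbit A x) ∈ subsystems A X :=
  ⟨isClosed_closure, (AddAction.nonempty_orbit x).closure,
    fun c => vadd_closure_orbit_subset c x⟩

theorem exists_minimal_subsystem [CompactSpace X] {S : Set X} (hS : S ∈ subsystems A X) :
    ∃ M ⊆ S, Minimal (· ∈ subsystems A X) M := by
  refine zorn_superset_nonempty _ (fun C hC hchain hne => ?_) S hS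
  have := hne.to_subtype
  refine ⟨⋂₀ C, ⟨isClosed_sInter fun T hT => (hC hT).1, ?_, fun c => ?_⟩,
    fun T hT => Set.sInter_subset_of_mem hT⟩
  · have hdir : DirectedOn (· ⊇ ·) C := IsChain.directedOn hchain.symm
    exact IsCompact.nonempty_sInter_of_directed_nonempty_isCompact_isClosed hdir
      (fun T hT => (hC hT).2.1) (fun T hT => (hC hT).1.isCompact) fun T hT => (hC hT).1
  · exact Set.subset_sInter fun T hT =>
      (Set.vadd_set_mono (Set.sInter_subset_of_mem hT)).trans ((hC hT).2.2 c)

theorem exists_isMinimal_subAddAction [ContinuousConstVAdd A X] [CompactSpace X] {S : Set X}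
    (hS : S ∈ subsystems A X) :
    ∃ M : SubAddAction A X, (M : Set X) ⊆ S ∧ IsClosed (M : Set X) ∧ (M : Set X).Nonempty ∧
      AddAction.IsMinimal A M := by
  obtain ⟨M, hMS, ⟨hMc, hMne, hM⟩, hmin⟩ := exists_minimal_subsystem hS
  refine ⟨⟨M, fun c {x} hx => hM c (Set.vadd_mem_vadd_set hx)⟩, hMS, hMc, hMne, ⟨fun x => ?_⟩⟩
  have hxM : closure (AddAction.orbit A x.1) ⊆ M :=
    hMc.closure_subset_iff.2 (Set.range_subset_iff.2 fun c => hM c (Set.vadd_mem_vadd_set x.2))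
  refine Subtype.dense_iff.2 ?_
  rw [SubAddAction.val_image_orbit]
  exact hmin (closure_orbit_mem_subsystems x.1) hxM

end MinimalSubsystem

section Coloring

variable {B A κ ι : Type*} [AddCommMonoid B] [AddCommGroup A]

/-- The action of `A` on the colourings of `A` by the shifts `(a +ᵥ ξ) b = ξ (a + b)`. -/
@[reducible] def shiftAddAction (A κ : Type*) [AddCommGroup A] : AddAction A (A → κ) where
  vadd := SymbolicDynamics.FullShift.shift
  zero_vadd := SymbolicDynamics.FullShift.shift_zero
  add_vadd a b ξ := add_comm b a ▸ SymbolicDynamics.FullShift.shift_add b a ξ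

attribute [local instance] shiftAddAction

theorem shift_vadd_apply (a b : A) (ξ : A → κ) : (a +ᵥ ξ) b = ξ (a + b) :=
  rfl

theorem exists_isIPStar_of_mem_polyMaps [Finite κ] {f : ι → B → A} (hf : ∀ i, f i ∈ polyMaps B A)
    (hf0 : ∀ i, f i 0 = 0) (s : Finset ι) (χ : A → κ) :
    ∃ l, IsIPStar {x | ∃ a, ∀ i ∈ s, χ (a + f i x) = l} := by
  let : TopologicalSpace κ := ⊥
  have : DiscreteTopology κ := ⟨rfl⟩
  have : ContinuousConstVAdd A (A → κ) := ⟨SymbolicDynamics.FullShift.continuous_shift⟩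
  obtain ⟨M, hMχ, hMc, ⟨ξ, hξ⟩, hM⟩ :=
    exists_isMinimal_subAddAction (closure_orbit_mem_subsystems (A := A) χ)
  have : CompactSpace M := isCompact_iff_compactSpace.1 hMc.isCompact
  have hrec : IsIPRecurrent M (f '' s) :=
    isIPRecurrent_of_subset_polyMaps (s.finite_toSet.image f)
      (Set.image_subset_iff.2 fun i _ => hf i) (Set.forall_mem_image.2 fun i _ => hf0 i)
  refine ⟨ξ 0, fun u => ?_⟩
  have hopen (b : A) : IsOpen {η : A → κ | η b = ξ 0} :=
    (isOpen_discrete {ξ 0}).preimage (continuous_apply (A := fun _ => κ) b)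
  obtain ⟨x, ⟨p, -, hp⟩, hxu⟩ :=
    hrec _ ((hopen 0).preimage continuous_subtype_val) ⟨⟨ξ, hξ⟩, rfl⟩ u
  have hp' : ∀ i ∈ s, p.1 (f i x) = ξ 0 := fun i hi => by
    simpa [shift_vadd_apply] using hp _ (Set.mem_image_of_mem f hi)
  have hW : IsOpen {η : A → κ | ∀ i ∈ s, η (f i x) = ξ 0} := by
    simpa only [Set.ofPred_forall] using isOpen_biInter_finset fun i _ => hopen (f i x)
  obtain ⟨_, hη, a, rfl⟩ := mem_closure_iff.1 (hMχ p.2) _ hW hp'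
  exact ⟨x, ⟨a, hη⟩, hxu⟩

end Coloring

section ZeroSumFree

variable (A : Type*) [AddCommGroup A] [Infinite A]

open Classical in
/-- A sequence in which no nonempty sum of distinct terms vanishes: each term avoids the negatives
of the sums of earlier terms. -/
noncomputable def zeroSumFreeSeq (n : ℕ) : A :=
  (Infinite.exists_notMem_finset
    (Finset.univ.image fun γ : Finset (Fin n) => -∑ j ∈ γ, zeroSumFreeSeq j)).choose

theorem zeroSumFreeSeq_ne_neg_sum {n : ℕ} (γ : Finset (Fin n)) :
    zeroSumFreeSeq A n ≠ -∑ j ∈ γ, zeroSumFreeSeq A j := by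
  classical
  intro h
  have hspec := (Infinite.exists_notMem_finset
    (Finset.univ.image fun γ : Finset (Fin n) => -∑ j ∈ γ, zeroSumFreeSeq A j)).choose_spec
  refine hspec (Finset.mem_image.2 ⟨γ, Finset.mem_univ γ, ?_⟩)
  rw [← h, zeroSumFreeSeq]

theorem zero_notMem_ipSet_zeroSumFreeSeq : 0 ∉ ipSet (zeroSumFreeSeq A) := by
  rintro ⟨γ, hγ, h0⟩
  have hlt : ∀ j ∈ γ.erase (γ.max' hγ), j < γ.max' hγ := fun j hj =>
    Finset.lt_max'_of_mem_erase_max' γ hγ hj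
  refine zeroSumFreeSeq_ne_neg_sum A ((γ.erase (γ.max' hγ)).attachFin hlt) ?_
  have hsum : ∑ j ∈ (γ.erase (γ.max' hγ)).attachFin hlt, zeroSumFreeSeq A j =
      ∑ j ∈ γ.erase (γ.max' hγ), zeroSumFreeSeq A j := by
    conv_rhs => rw [← Finset.map_valEmbedding_attachFin hlt, Finset.sum_map]
    rfl
  rw [eq_neg_iff_add_eq_zero, hsum, Finset.add_sum_erase _ _ (γ.max'_mem hγ), ← h0]

end ZeroSumFree

theorem IsRingPolynomial.mem_polyMaps {G : Type*} [NonUnitalRing G] {n : ℕ} {p : (Fin n → G) → G}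
    (hp : IsRingPolynomial p) : p ∈ polyMaps (Fin n → G) G := by
  induction hp using NonUnitalSubring.closure_induction with
  | mem f hf =>
    rcases hf with ⟨c, rfl⟩ | ⟨i, rfl⟩
    · exact const_mem_polyMaps c
    · exact addMonoidHom_mem_polyMaps (Pi.evalAddMonoidHom (fun _ => G) i)
  | zero => exact zero_mem _
  | add f g _ _ hf hg => exact add_mem hf hg
  | neg f _ hf => exact neg_mem hf
  | mul f g _ _ hf hg => exact mul_mem_polyMaps hf hg

theorem IsRingPolynomialMap.mem_polyMaps {G : Type*} [NonUnitalRing G] {n t : ℕ}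
    {P : (Fin n → G) → (Fin t → G)} (hP : IsRingPolynomialMap P) :
    P ∈ polyMaps (Fin n → G) (Fin t → G) :=
  mem_polyMaps_of_forall_comp (Pi.evalAddMonoidHom _) (fun _ => funext) fun i => (hP i).mem_polyMaps

theorem mvPolynomial_eval_mem_polyMaps {R σ : Type*} [CommRing R] (p : MvPolynomial σ R) :
    (fun x => MvPolynomial.eval x p) ∈ polyMaps (σ → R) R := by
  induction p using MvPolynomial.induction_on with
  | C a => simpa only [MvPolynomial.eval_C] using const_mem_polyMaps a
  | add p q hp hq =>
    simp only [map_add]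
    exact add_mem hp hq
  | mul_X p i hp =>
    simp only [map_mul, MvPolynomial.eval_X]
    exact mul_mem_polyMaps hp (addMonoidHom_mem_polyMaps (Pi.evalAddMonoidHom (fun _ => R) i))

theorem IsIntPolynomialMap.mem_polyMaps {t m : ℕ} {P : (Fin t → ℤ) → (Fin m → ℤ)}
    (hP : IsIntPolynomialMap P) : P ∈ polyMaps (Fin t → ℤ) (Fin m → ℤ) := by
  refine mem_polyMaps_of_forall_comp
    (fun i => (Int.castAddHom ℚ).comp (Pi.evalAddMonoidHom _ i))
    (fun _ ha => funext fun i => Int.cast_eq_zero.1 (ha i)) fun i => ?_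
  obtain ⟨p, hp⟩ := hP i
  convert comp_mem_polyMaps (mvPolynomial_eval_mem_polyMaps p)
    ((Int.castAddHom ℚ).compLeft (Fin t)) using 1
  exact funext hp

theorem IsVectorPolynomialMap.smul_mem_polyMaps {K W V : Type*} [Field K] [AddCommGroup W]
    [Module K W] [AddCommGroup V] [Module K V] {P : W → V} (hP : IsVectorPolynomialMap K P)
    (w : W) : (fun x : K => P (x • w)) ∈ polyMaps K V := by
  obtain ⟨d, M, hM⟩ := hP
  have hP : (fun x : K => P (x • w)) =
      ∑ k ∈ Finset.range (d + 1), fun x => x ^ k • M k fun _ => w := by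
    ext x
    simp [hM, Finset.sum_apply, MultilinearMap.map_smul_univ]
  rw [hP]
  exact sum_mem fun k _ => biadditive_mem_polyMaps (smulAddHom K V)
    (pow_mem_polyMaps (addMonoidHom_mem_polyMaps (AddMonoidHom.id K)) k) (const_mem_polyMaps _)

theorem exists_isIPStar_mul {R A κ : Type*} [NonUnitalNonAssocSemiring R] [AddCommGroup A]
    [Finite κ] {P : R → A} (hP : P ∈ polyMaps R A) (hP0 : P 0 = 0) (F : Finset R) (χ : A → κ) :
    ∃ l, IsIPStar {x | ∃ a, ∀ v ∈ F, χ (a + P (x * v)) = l} :=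
  exists_isIPStar_of_mem_polyMaps (fun v => comp_mem_polyMaps hP (AddMonoidHom.mulRight v))
    (fun v => by simp [hP0]) F χ

theorem corollary7p14 :
    -- polynomial mappings over an arbitrary ring
    (∀ (G : Type*) [NonUnitalRing G] (n t : ℕ) (P : (Fin n → G) → (Fin t → G)),
      IsRingPolynomialMap P → P 0 = 0 →
      ∀ (F : Finset (Fin n → G)) (r : ℕ) (χ : (Fin t → G) → Fin r),
        ∃ l : Fin r, IsIPStar {x : Fin n → G |
          ∃ h : Fin t → G, ∀ v ∈ F, χ (h + P (fun i => x i * v i)) = l}) ∧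
    -- integer-valued polynomial mappings, along a given IP-set
    (∀ (t m : ℕ) (P : (Fin t → ℤ) → (Fin m → ℤ)),
      IsIntPolynomialMap P → P 0 = 0 →
      ∀ (F : Finset (Fin t → ℤ)) (u : ℕ → Fin t → ℤ) (r : ℕ) (χ : (Fin m → ℤ) → Fin r),
        ∃ (a : Fin m → ℤ) (γ : Finset ℕ), γ.Nonempty ∧
          ∃ l : Fin r, ∀ v ∈ F, χ (a + P (fun i => (∑ j ∈ γ, u j i) * v i)) = l) ∧
    -- integer-valued polynomial mappings, with one color for all IP-sets
    (∀ (t m : ℕ) (P : (Fin t → ℤ) → (Fin m → ℤ)),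
      IsIntPolynomialMap P → P 0 = 0 →
      ∀ (F : Finset (Fin t → ℤ)) (r : ℕ) (χ : (Fin m → ℤ) → Fin r),
        ∃ l : Fin r, IsIPStar {x : Fin t → ℤ |
          ∃ a : Fin m → ℤ, ∀ v ∈ F, χ (a + P (fun i => x i * v i)) = l}) ∧
    -- polynomial mappings of vector spaces over an infinite field
    (∀ (K W V : Type*) [Field K] [Infinite K] [AddCommGroup W] [Module K W]
        [AddCommGroup V] [Module K V] (P : W → V),
      IsVectorPolynomialMap K P → P 0 = 0 →
      ∀ (F : Finset W) (r : ℕ) (χ : V → Fin r),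
        (∃ (a : V) (x : K), x ≠ 0 ∧ ∃ l : Fin r, ∀ v ∈ F, χ (a + P (x • v)) = l) ∧
        ∃ l : Fin r, IsIPStar {x : K |
          ∃ a : V, ∀ v ∈ F, χ (a + P (x • v)) = l}) := by
  refine ⟨fun G _ n t P hP hP0 F r χ => exists_isIPStar_mul hP.mem_polyMaps hP0 F χ,
    fun t m P hP hP0 F u r χ => ?_,
    fun t m P hP hP0 F r χ => exists_isIPStar_mul hP.mem_polyMaps hP0 F χ,
    fun K W V _ _ _ _ _ _ P hP hP0 F r χ => ?_⟩
  · obtain ⟨l, hl⟩ := exists_isIPStar_mul hP.mem_polyMaps hP0 F χ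
    obtain ⟨_, ⟨a, ha⟩, γ, hγ, rfl⟩ := hl u
    exact ⟨a, γ, hγ, l, fun v hv => by simpa only [Pi.mul_def, Finset.sum_apply] using ha v hv⟩
  · obtain ⟨l, hl⟩ := exists_isIPStar_of_mem_polyMaps (fun v => hP.smul_mem_polyMaps v)
      (fun v => by rw [zero_smul, hP0]) F χ
    obtain ⟨x, ⟨a, ha⟩, hx⟩ := hl (zeroSumFreeSeq K)
    exact ⟨⟨a, x, fun h0 => zero_notMem_ipSet_zeroSumFreeSeq K (h0 ▸ hx), l, ha⟩, l, hl⟩
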